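/- **Setting.** Let $\mathcal U,\mathcal X$ be Hausdorff spaces, $f\colon\mathcal X\times\mathcal U\to\mathcal X$ continuous, and $\mathbb Z_-=\{0,-1,-2,\dots\}$. Write $T$ for the right shift $(Tx)_t=x_{t-1}$. Let $U^-\subseteq\mathcal U^{\mathbb Z_-}$ and $X^-\subseteq\mathcal X^{\mathbb Z_-}$ satisfy $T^{-1}(U^-)=U^-$ and $T^{-1}(X^-)=X^-$. Equip $U^-$ with the product topology and $X^-$ with a topology at least as fine as the product topology, for which $T\colon X^-\to X^-$ and the concatenation $X^-\times\mathcal X\to X^-$, $(x,a)\mapsto(\dots,x_{-1},x_0,a)$, are continuous. Assume that $U^-$ and $X^-$ are Polish. For a Polish space $Z$ let $P(Z)$ be the set of Borel probability measures on $Z$. The shift $T$ acts on $X^-\times U^-$ componentwise, $\pi\colon X^-\times U^-\to U^-$ is the projection, and $g_*$ denotes push-forward of measures under $g$. Let $\mathcal P_{\mathrm{in}}\subseteq P(U^-)$ and $\mathcal P_{\mathrm{state}}\subseteq P(X^-\times U^-)$ satisfy $(T_*)^{-1}(\mathcal P_{\mathrm{in}})=\mathcal P_{\mathrm{in}}$,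 $(T_*)^{-1}(\mathcal P_{\mathrm{state}})=\mathcal P_{\mathrm{state}}$ and $\pi_*(\mathcal P_{\mathrm{state}})=\mathcal P_{\mathrm{in}}$, each endowed with a topology at least as fine as the weak topology. For $n\ge 0$ let $\gamma^n\colon U^-\times U^-\to U^-$, $\gamma^n(u',u)=(\dots,u'_{-1},u'_0,u_{-n},\dots,u_0)$, and assume that for all $\Xi,\Xi'\in\mathcal P_{\mathrm{in}}$ the laws $\gamma^n_*(\Xi'\otimes\Xi)$ (which belong to $\mathcal P_{\mathrm{in}}$) converge to $\Xi$ in $\mathcal P_{\mathrm{in}}$ as $n\to\infty$. **Definitions.** A measure $\mu\in\mathcal P_{\mathrm{state}}$ is a *stochastic solution* for the input law $\Xi=\pi_*\mu$ if a pair $(X,U)$ of law $\mu$ satisfies $X_t=f(X_{t-1},U_t)$ almost surely for every $t\in\mathbb Z_-$. It is *causal* if for every $t\in\mathbb Z_-$ the sigma-algebras on $X^-\times U^-$ generated by $(x,u)\mapsto T^{-t}x$ and by $(x,u)\mapsto u$ are conditionally independent under $\mu$ given the sigma-algebra generated by $(x,u)\mapsto T^{-t}u$. For $\Xi\in\mathcal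 P_{\mathrm{in}}$ let $\mathcal S(\Xi)\subseteq\mathcal P_{\mathrm{state}}$ be the set of causal stochastic solutions for $\Xi$, and $\#\mathcal S(\Xi)\in\mathbb N_0\cup\{\infty\}$ its size (all infinite sizes are identified). A set-valued map $F\colon V\to 2^W$ between topological spaces is *hemi-continuous* at $v$ if for all open $W_1,W_2\subseteq W$ with $W_1\cap F(v)\ne\emptyset$ and $F(v)\subseteq W_2$ there is an open neighbourhood $N$ of $v$ with $W_1\cap F(v')\neq\emptyset$ and $F(v')\subseteq W_2$ for all $v'\in N$. Let $D\subseteq\mathcal P_{\mathrm{in}}$ be the set of all $\Xi$ at which $\mathcal S\colon\mathcal P_{\mathrm{in}}\to 2^{\mathcal P_{\mathrm{state}}}$ is hemi-continuous. The system has the *causal stochastic fading memory property (FMP)* if $D=\mathcal P_{\mathrm{in}}$, and the *causal stochastic echo state property (ESP)* if $\#\mathcal S(\Xi)=1$ for every $\Xi\in\mathcal P_{\mathrm{in}}$. **Proposition.** There is $M\in\mathbb N_0\cup\{\infty\}$ with $\#\mathcal S(\Xi)=M$ for all $\Xi\in D$ and $\#\mathcal S(\Xi)\ge M$ for all $\Xi\in\mathcal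 P_{\mathrm{in}}$. In particular, if the system has the causal stochastic FMP, then $\#\mathcal S(\Xi)$ is constant on $\mathcal P_{\mathrm{in}}$; and if it has the causal stochastic FMP and $\#\mathcal S(\Xi)=1$ for some $\Xi\in\mathcal P_{\mathrm{in}}$, then it has the causal stochastic ESP. -/

import Mathlib

open MeasureTheory ProbabilityTheory Filter Topology

namespace SSS

/-! Left-infinite sequences `(…, x₋₂, x₋₁, x₀)` are functions on `ℕ`, where `x n` is the entry at
time `-n`. -/

section Sequences

variable {α : Type*}

/-- The right shift `T`: `(T x)_t = x_{t-1}`. -/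
def seqShift (x : ℕ → α) : ℕ → α := fun n => x (n + 1)

/-- The concatenation `(…, x₋₁, x₀, a)`. -/
def seqSnoc (x : ℕ → α) (a : α) : ℕ → α
  | 0 => a
  | n + 1 => x n

/-- `γⁿ(u', u) = (…, u'₋₁, u'₀, u₋ₙ, …, u₀)`. -/
def seqSplice (n : ℕ) (u' u : ℕ → α) : ℕ → α :=
  fun k => if k ≤ n then u k else u' (k - (n + 1))

/-- `T⁻¹(S) = S`. -/
def BackwardShiftInvariant (S : Set (ℕ → α)) : Prop := seqShift ⁻¹' S = S

theorem seqShift_mem {S : Set (ℕ → α)} (hS : BackwardShiftInvariant S) {x : ℕ → α} :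
    seqShift x ∈ S ↔ x ∈ S := by
  change x ∈ seqShift ⁻¹' S ↔ x ∈ S
  rw [hS]

theorem seqShift_iterate (k : ℕ) (x : ℕ → α) : seqShift^[k] x = fun n => x (n + k) := by
  induction k generalizing x with
  | zero => rfl
  | succ k ih =>
    rw [Function.iterate_succ_apply, ih]
    funext n
    simp only [seqShift]
    congr 1

theorem seqShift_iterate_mem {S : Set (ℕ → α)} (hS : BackwardShiftInvariant S) (k : ℕ)
    {x : ℕ → α} : seqShift^[k] x ∈ S ↔ x ∈ S := by
  induction k generalizing x with
  | zero => rfl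
  | succ k ih => rw [Function.iterate_succ_apply, ih, seqShift_mem hS]

theorem seqShift_iterate_seqSplice (n : ℕ) (u' u : ℕ → α) :
    seqShift^[n + 1] (seqSplice n u' u) = u' := by
  rw [seqShift_iterate]
  funext k
  have h : ¬ (k + (n + 1) ≤ n) := by omega
  simp [seqSplice, h]

end Sequences

/-- The subset `S` regarded as a type of its own, without the subspace topology: the topologies
used on sets of sequences and on sets of laws may be finer. -/
@[ext] structure Members {α : Type*} (S : Set α) where
  val : α
  property : val ∈ S

section MembersMaps

variable {α : Type*} {S : Set (ℕ → α)}

/-- The right shift on a backwards shift-invariant set of sequences. -/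
def shift (hS : BackwardShiftInvariant S) (x : Members S) : Members S :=
  ⟨seqShift x.val, (seqShift_mem hS).2 x.property⟩

/-- The concatenation map `(x, a) ↦ (…, x₋₁, x₀, a)`. -/
def snoc (hS : BackwardShiftInvariant S) (x : Members S) (a : α) : Members S :=
  ⟨seqSnoc x.val a, (seqShift_mem hS).1 x.property⟩

/-- The map `γⁿ` on pairs `(u', u)`. -/
def splice (hS : BackwardShiftInvariant S) (n : ℕ) (p : Members S × Members S) : Members S :=
  ⟨seqSplice n p.1.val p.2.val, (seqShift_iterate_mem hS (n + 1)).1 (by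
    rw [seqShift_iterate_seqSplice]; exact p.1.property)⟩

theorem shift_iterate_val (hS : BackwardShiftInvariant S) (k : ℕ) (x : Members S) :
    ((shift hS)^[k] x).val = seqShift^[k] x.val := by
  induction k generalizing x with
  | zero => rfl
  | succ k ih => rw [Function.iterate_succ_apply, ih, Function.iterate_succ_apply]; rfl

theorem shift_iterate_splice (hS : BackwardShiftInvariant S) (n : ℕ)
    (p : Members S × Members S) : (shift hS)^[n + 1] (splice hS n p) = p.1 := by
  apply Members.ext
  rw [shift_iterate_val]
  exact seqShift_iterate_seqSplice n _ _

variable [TopologicalSpace α] [TopologicalSpace (Members S)]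

theorem continuous_shift (hS : BackwardShiftInvariant S)
    (h : IsInducing (Members.val : Members S → ℕ → α)) : Continuous (shift hS) := by
  rw [h.continuous_iff]
  exact continuous_pi fun n => (continuous_apply (n + 1)).comp h.continuous

theorem continuous_splice (hS : BackwardShiftInvariant S)
    (h : IsInducing (Members.val : Members S → ℕ → α)) (n : ℕ) : Continuous (splice hS n) := by
  rw [h.continuous_iff]
  refine continuous_pi fun k => ?_
  by_cases hk : k ≤ n
  · have : (fun p : Members S × Members S => (Members.val ∘ splice hS n) p k)
        = fun p => p.2.val k := by
      funext p; simp [splice, seqSplice, hk]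
    rw [this]
    exact (continuous_apply k).comp (h.continuous.comp continuous_snd)
  · have : (fun p : Members S × Members S => (Members.val ∘ splice hS n) p k)
        = fun p => p.1.val (k - (n + 1)) := by
      funext p; simp [splice, seqSplice, hk]
    rw [this]
    exact (continuous_apply (k - (n + 1))).comp (h.continuous.comp continuous_fst)

end MembersMaps

/-- The push-forward `g_* μ` of a probability measure. -/
noncomputable def pushforward {Ω Ω' : Type*} [MeasurableSpace Ω] [MeasurableSpace Ω'] {g : Ω → Ω'}
    (hg : Measurable g) (μ : ProbabilityMeasure Ω) : ProbabilityMeasure Ω' :=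
  μ.map hg.aemeasurable

theorem pushforward_iterate_mem {Ω : Type*} [MeasurableSpace Ω] {g : Ω → Ω} (hg : Measurable g)
    {P : Set (ProbabilityMeasure Ω)} (hP : pushforward hg ⁻¹' P = P) (k : ℕ)
    (μ : ProbabilityMeasure Ω) : pushforward (hg.iterate k) μ ∈ P ↔ μ ∈ P := by
  induction k generalizing μ with
  | zero =>
    have : pushforward (hg.iterate 0) μ = μ := by
      apply Subtype.ext
      exact Measure.map_id
    rw [this]
  | succ k ih =>
    have h1 : pushforward (hg.iterate (k + 1)) μ
        = pushforward (hg.iterate k) (pushforward hg μ) := by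
      apply Subtype.ext
      exact (Measure.map_map (hg.iterate k) hg).symm
    rw [h1, ih]
    change μ ∈ pushforward hg ⁻¹' P ↔ μ ∈ P
    rw [hP]

/-- Hemi-continuity of a set-valued map at a point: for all open `W`, `W'` with `W ∩ F v ≠ ∅` and
`F v ⊆ W'` there is an open neighbourhood `V` of `v` such that `W ∩ F v' ≠ ∅` and `F v' ⊆ W'` for
all `v' ∈ V`. -/
def HemicontinuousAt {V W : Type*} [TopologicalSpace V] [TopologicalSpace W] (F : V → Set W)
    (v : V) : Prop :=
  ∀ W₁ W₂ : Set W, IsOpen W₁ → IsOpen W₂ → (W₁ ∩ F v).Nonempty → F v ⊆ W₂ →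
    ∃ N : Set V, IsOpen N ∧ v ∈ N ∧ ∀ v' ∈ N, (W₁ ∩ F v').Nonempty ∧ F v' ⊆ W₂

section SigmaAlgebras

variable {U X : Type*} {US : Set (ℕ → U)} {XS : Set (ℕ → X)} [MeasurableSpace (Members US)]
  [MeasurableSpace (Members XS)]

/-- The sigma-algebra on `XS × US` generated by `(x, u) ↦ Tⁿ x`, i.e. by the states up to time
`-n`. -/
abbrev stateSigma (US : Set (ℕ → U)) (hXS : BackwardShiftInvariant XS) (n : ℕ) :
    MeasurableSpace (Members XS × Members US) :=
  MeasurableSpace.comap (fun p => (shift hXS)^[n] p.1) inferInstance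

/-- The sigma-algebra on `XS × US` generated by `(x, u) ↦ Tⁿ u`, i.e. by the inputs up to time
`-n`. -/
abbrev inputSigma (XS : Set (ℕ → X)) (hUS : BackwardShiftInvariant US) (n : ℕ) :
    MeasurableSpace (Members XS × Members US) :=
  MeasurableSpace.comap (fun p => (shift hUS)^[n] p.2) inferInstance

theorem inputSigma_le (XS : Set (ℕ → X)) [MeasurableSpace (Members XS)]
    (hUS : BackwardShiftInvariant US) (hT : Measurable (shift hUS)) (n : ℕ) :
    inputSigma XS hUS n ≤ (inferInstance : MeasurableSpace (Members XS × Members US)) :=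
  ((hT.iterate n).comp measurable_snd).comap_le

end SigmaAlgebras

section Laws

variable {U X : Type*} {US : Set (ℕ → U)} {XS : Set (ℕ → X)}
  [TopologicalSpace (Members US)] [MeasurableSpace (Members US)] [BorelSpace (Members US)]
  [PolishSpace (Members US)]
  [TopologicalSpace (Members XS)] [MeasurableSpace (Members XS)] [BorelSpace (Members XS)]
  [PolishSpace (Members XS)]

/-- `γⁿ_*(Ξ' ⊗ Ξ)`, an element of the given set of input laws. -/
noncomputable def spliceLaw [TopologicalSpace U] (hUS : BackwardShiftInvariant US)
    (hU : IsInducing (Members.val : Members US → ℕ → U))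
    {Pin : Set (ProbabilityMeasure (Members US))}
    (hPin : pushforward (continuous_shift hUS hU).measurable ⁻¹' Pin = Pin)
    (Ξ' Ξ : Members Pin) (n : ℕ) : Members Pin where
  val := pushforward (continuous_splice hUS hU n).measurable (Ξ'.val.prod Ξ.val)
  property := by
    rw [← pushforward_iterate_mem (continuous_shift hUS hU).measurable hPin (n + 1)]
    have h : pushforward ((continuous_shift hUS hU).measurable.iterate (n + 1))
        (pushforward (continuous_splice hUS hU n).measurable (Ξ'.val.prod Ξ.val)) = Ξ'.val := by
      apply Subtype.ext
      change Measure.map _ (Measure.map _ 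
        ((Ξ'.val : Measure (Members US)).prod (Ξ.val : Measure (Members US)))) = _
      rw [Measure.map_map ((continuous_shift hUS hU).measurable.iterate (n + 1))
        (continuous_splice hUS hU n).measurable]
      have h2 : (shift hUS)^[n + 1] ∘ splice hUS n = Prod.fst :=
        funext (shift_iterate_splice hUS n)
      rw [h2]
      simp
    rw [h]
    exact Ξ'.property

/-- `μ` is the law of a pair that satisfies `x_t = f(x_{t-1}, u_t)` almost surely for all `t ≤ 0`.
(Under `μ` the coordinate maps are a realization of `μ`; the property only depends on the law.) -/
def IsStochasticSolution (f : X × U → X) (μ : ProbabilityMeasure (Members XS × Members US)) :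
    Prop :=
  ∀ n : ℕ, ∀ᵐ p ∂(μ : Measure (Members XS × Members US)),
    p.1.val n = f (p.1.val (n + 1), p.2.val n)

/-- A law is causal if, for every `t ≤ 0`, the states up to time `t` and all inputs are
conditionally independent given the inputs up to time `t`. -/
def IsCausal (hXS : BackwardShiftInvariant XS) (hUS : BackwardShiftInvariant US)
    (hT : Measurable (shift hUS)) (μ : ProbabilityMeasure (Members XS × Members US)) : Prop :=
  ∀ n : ℕ, CondIndep (inputSigma XS hUS n) (stateSigma US hXS n) (inputSigma XS hUS 0)
    (inputSigma_le XS hUS hT n) (μ : Measure (Members XS × Members US))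

/-- The causal stochastic solutions in `Pstate` for the input law `Ξ`. -/
def causalSolutions (f : X × U → X) (hXS : BackwardShiftInvariant XS)
    (hUS : BackwardShiftInvariant US) (hT : Measurable (shift hUS))
    (Pstate : Set (ProbabilityMeasure (Members XS × Members US)))
    (Ξ : ProbabilityMeasure (Members US)) : Set (Members Pstate) :=
  {μ | IsStochasticSolution f μ.val ∧ IsCausal hXS hUS hT μ.val ∧
    pushforward measurable_snd μ.val = Ξ}

/-- The causal stochastic echo state property: every input law in `Pin` has a unique causal
stochastic solution in `Pstate`. -/
def HasCausalStochasticESP (f : X × U → X) (hXS : BackwardShiftInvariant XS)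
    (hUS : BackwardShiftInvariant US) (hT : Measurable (shift hUS))
    (Pin : Set (ProbabilityMeasure (Members US)))
    (Pstate : Set (ProbabilityMeasure (Members XS × Members US))) : Prop :=
  ∀ Ξ : Members Pin, ∃! μ : Members Pstate, μ ∈ causalSolutions f hXS hUS hT Pstate Ξ.val

/-- The set of input laws at which the causal stochastic fading memory property holds. -/
def causalFMPSet (f : X × U → X) (hXS : BackwardShiftInvariant XS)
    (hUS : BackwardShiftInvariant US) (hT : Measurable (shift hUS))
    (Pin : Set (ProbabilityMeasure (Members US)))
    (Pstate : Set (ProbabilityMeasure (Members XS × Members US)))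
    [TopologicalSpace (Members Pin)] [TopologicalSpace (Members Pstate)] : Set (Members Pin) :=
  {Ξ | HemicontinuousAt (fun Ξ : Members Pin => causalSolutions f hXS hUS hT Pstate Ξ.val) Ξ}

/-- The causal stochastic fading memory property (at all input laws). -/
def HasCausalStochasticFMP (f : X × U → X) (hXS : BackwardShiftInvariant XS)
    (hUS : BackwardShiftInvariant US) (hT : Measurable (shift hUS))
    (Pin : Set (ProbabilityMeasure (Members US)))
    (Pstate : Set (ProbabilityMeasure (Members XS × Members US)))
    [TopologicalSpace (Members Pin)] [TopologicalSpace (Members Pstate)] : Prop :=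
  causalFMPSet f hXS hUS hT Pin Pstate = Set.univ

end Laws

end SSS

/-! Fix `Ξ` in the hemi-continuity set `D` and any admissible input law `Ξ'`. The laws `γⁿ_*(Ξ' ⊗
Ξ)` converge to `Ξ`, while their remote past is distributed as `Ξ'`. Shifting by `n + 1` steps maps
causal solutions for the spliced law to causal solutions for `Ξ'`. This map is injective: causality
fixes the joint law of past states and all inputs, and the recursion then rebuilds the recent states
(`IsStochasticSolution.eq_of_pushforward_shift_eq`). So the spliced laws have at most as many
solutions as `Ξ'` (`encard_causalSolutions_spliceLaw_le`). The number of solutions is lower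
semicontinuous at `Ξ` because the space of laws is Hausdorff
(`HemicontinuousAt.encard_le_of_tendsto`), so `Ξ` also has at most as many solutions as `Ξ'`.
Exchanging the roles of two points of `D` gives equality. -/

namespace SSS

/-! ### Conditional independence in terms of laws. -/

section ConditionalIndependence

variable {Ω Ω' E F G : Type*} [MeasurableSpace Ω] [StandardBorelSpace Ω]
  [MeasurableSpace Ω'] [StandardBorelSpace Ω']
  [MeasurableSpace E] [StandardBorelSpace E] [Nonempty E]
  [MeasurableSpace F] [StandardBorelSpace F] [Nonempty F] [MeasurableSpace G]

/-- Conditional independence of random variables under a push-forward measure. -/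
theorem condIndepFun_map_iff {μ : Measure Ω} [IsProbabilityMeasure μ] {S : Ω → Ω'}
    (hS : Measurable S) {Y : Ω' → E} {Z : Ω' → F} {W : Ω' → G} (hY : Measurable Y)
    (hZ : Measurable Z) (hW : Measurable W) [IsFiniteMeasure (μ.map S)] :
    CondIndepFun (MeasurableSpace.comap W inferInstance) hW.comap_le Y Z (μ.map S) ↔
      CondIndepFun (MeasurableSpace.comap (W ∘ S) inferInstance) (hW.comp hS).comap_le
        (Y ∘ S) (Z ∘ S) μ := by
  -- This criterion is an identity between image measures of `(W, Y, Z)` and of its sub-tuples, so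
  -- it transfers along `S`.
  rw [condIndepFun_iff_map_prod_eq_prod_condDistrib_prod_condDistrib hY hZ hW,
    condIndepFun_iff_map_prod_eq_prod_condDistrib_prod_condDistrib (hY.comp hS) (hZ.comp hS)
      (hW.comp hS)]
  simp only [condDistrib, Measure.map_map hW hS, Measure.map_map (hW.prodMk hY) hS,
    Measure.map_map (hW.prodMk hZ) hS, Measure.map_map (hW.prodMk (hY.prodMk hZ)) hS]
  rfl

/-- If `Y` and `Z` are conditionally independent given `φ(Z)`, then their joint law is determined
by the joint law of `φ(Z)` and `Y` and the law of `Z`. -/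
theorem map_prodMk_eq_of_condIndepFun {μ ν : Measure Ω} [IsProbabilityMeasure μ]
    [IsProbabilityMeasure ν] {Y : Ω → E} {Z : Ω → F} {φ : F → G} (hY : Measurable Y)
    (hZ : Measurable Z) (hφ : Measurable φ)
    (hμ : CondIndepFun (MeasurableSpace.comap (φ ∘ Z) inferInstance) (hφ.comp hZ).comap_le Y Z μ)
    (hν : CondIndepFun (MeasurableSpace.comap (φ ∘ Z) inferInstance) (hφ.comp hZ).comap_le Y Z ν)
    (hpast : μ.map (fun ω => (φ (Z ω), Y ω)) = ν.map (fun ω => (φ (Z ω), Y ω)))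
    (hlaw : μ.map Z = ν.map Z) :
    μ.map (fun ω => (Y ω, Z ω)) = ν.map (fun ω => (Y ω, Z ω)) := by
  have hW : Measurable (φ ∘ Z) := hφ.comp hZ
  rw [condIndepFun_iff_map_prod_eq_prod_condDistrib_prod_condDistrib hY hZ hW] at hμ hν
  have hWlaw : μ.map (φ ∘ Z) = ν.map (φ ∘ Z) := by
    rw [← Measure.map_map hφ hZ, hlaw, Measure.map_map hφ hZ]
  have hWZ : μ.map (fun ω => ((φ ∘ Z) ω, Z ω)) = ν.map (fun ω => ((φ ∘ Z) ω, Z ω)) := by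
    have h := congrArg (Measure.map fun z => (φ z, z)) hlaw
    have hpair : Measurable fun z => (φ z, z) := hφ.prodMk measurable_id
    rwa [Measure.map_map hpair hZ, Measure.map_map hpair hZ] at h
  -- `condDistrib` is built from the joint law alone, so equal joint laws give equal kernels, not
  -- merely almost everywhere equal ones.
  have hY' : condDistrib Y (φ ∘ Z) μ = condDistrib Y (φ ∘ Z) ν := by
    simp only [condDistrib, Function.comp_apply, hpast]
  have hZ' : condDistrib Z (φ ∘ Z) μ = condDistrib Z (φ ∘ Z) ν := by
    simp only [condDistrib, hWZ]
  rw [hWlaw, hY', hZ', ← hν] at hμ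
  have h := congrArg (Measure.map Prod.snd) hμ
  rwa [Measure.map_map measurable_snd (hW.prodMk (hY.prodMk hZ)),
    Measure.map_map measurable_snd (hW.prodMk (hY.prodMk hZ))] at h

end ConditionalIndependence

/-! ### Lower semicontinuity of cardinality. -/

section Topology

/-- Lower semicontinuity of the size of a set-valued map with values in a Hausdorff space. -/
theorem HemicontinuousAt.eventually_le_encard {V W : Type*} [TopologicalSpace V]
    [TopologicalSpace W] [T2Space W] {F : V → Set W} {v : V} (h : HemicontinuousAt F v)
    {s : Set W} (hs : s.Finite) (hsF : s ⊆ F v) : ∀ᶠ v' in 𝓝 v, s.encard ≤ (F v').encard := by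
  obtain ⟨O, hO, hdisj⟩ := hs.t2_separation
  have hev : ∀ w ∈ s, ∀ᶠ v' in 𝓝 v, (O w ∩ F v').Nonempty := by
    intro w hw
    -- Only the lower half of hemi-continuity matters, hence the trivial choice `W₂ = univ`.
    obtain ⟨N, hN, hvN, hN'⟩ := h (O w) Set.univ (hO w).2 isOpen_univ
      ⟨w, (hO w).1, hsF hw⟩ (Set.subset_univ _)
    filter_upwards [hN.mem_nhds hvN] with v' hv' using (hN' v' hv').1
  filter_upwards [hs.eventually_all.2 hev] with v' hv'
  choose! g hg using hv'
  refine Set.encard_le_encard_of_injOn (f := g) (fun w hw => (hg w hw).2) ?_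
  intro a ha b hb hab
  by_contra hne
  exact Set.disjoint_left.1 (hdisj ha hb hne) (hg a ha).1 (hab ▸ (hg b hb).1)

/-- If `F` is hemi-continuous at the limit `v` of points at which the size of `F` is at most `m`,
then the size of `F v` is at most `m`. -/
theorem HemicontinuousAt.encard_le_of_tendsto {V W ι : Type*} [TopologicalSpace V]
    [TopologicalSpace W] [T2Space W] {F : V → Set W} {v : V} (h : HemicontinuousAt F v)
    {l : Filter ι} [l.NeBot] {u : ι → V} (hu : Tendsto u l (𝓝 v)) {m : ℕ∞}
    (hm : ∀ i, (F (u i)).encard ≤ m) : (F v).encard ≤ m := by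
  -- Testing against finite `k` covers an infinite `F v` as well: finite subsets suffice.
  refine ENat.forall_natCast_le_iff_le.1 fun k hk => ?_
  obtain ⟨s, hsF, hsk⟩ := Set.exists_subset_encard_eq hk
  have hs : s.Finite := Set.finite_of_encard_eq_coe hsk
  obtain ⟨i, hi⟩ := (hu.eventually (h.eventually_le_encard hs hsF)).exists
  exact hsk ▸ hi.trans (hm i)

end Topology

/-! ### Rebuilding states from a past and the inputs. -/

section Reconstruction

variable {U X : Type*} {US : Set (ℕ → U)} {XS : Set (ℕ → X)}

/-- The state sequence obtained by driving the system for `m` steps, from a given past, with the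
last `m` entries of an input sequence. -/
def drive (f : X × U → X) (hXS : BackwardShiftInvariant XS) (hUS : BackwardShiftInvariant US) :
    ℕ → Members XS × Members US → Members XS
  | 0, p => p.1
  | m + 1, p =>
    snoc hXS (drive f hXS hUS m (p.1, shift hUS p.2))
      (f ((drive f hXS hUS m (p.1, shift hUS p.2)).val 0, p.2.val 0))

theorem drive_shift_iterate {f : X × U → X} (hXS : BackwardShiftInvariant XS)
    (hUS : BackwardShiftInvariant US) (m : ℕ) (x : Members XS) (u : Members US)
    (h : ∀ n, x.val n = f (x.val (n + 1), u.val n)) :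
    drive f hXS hUS m ((shift hXS)^[m] x, u) = x := by
  induction m generalizing x u with
  | zero => rfl
  | succ m ih =>
    -- The shifted pair satisfies the recursion too, so only the newest entry, given by `h 0`,
    -- remains.
    have h1 := ih (shift hXS x) (shift hUS u) fun n => h (n + 1)
    rw [drive, Function.iterate_succ_apply, h1]
    apply Members.ext
    funext n
    cases n with
    | zero => exact (h 0).symm
    | succ n => rfl

variable [TopologicalSpace U] [TopologicalSpace X] [TopologicalSpace (Members US)]
  [TopologicalSpace (Members XS)]

theorem continuous_drive {f : X × U → X} (hf : Continuous f) (hXS : BackwardShiftInvariant XS)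
    (hUS : BackwardShiftInvariant US) (hU : IsInducing (Members.val : Members US → ℕ → U))
    (hX : Continuous (Members.val : Members XS → ℕ → X))
    (hXsnoc : Continuous fun p : Members XS × X => snoc hXS p.1 p.2) (m : ℕ) :
    Continuous (drive f hXS hUS m) := by
  induction m with
  | zero => exact continuous_fst
  | succ m ih =>
    have h1 : Continuous fun p : Members XS × Members US =>
        drive f hXS hUS m (p.1, shift hUS p.2) :=
      ih.comp (continuous_fst.prodMk ((continuous_shift hUS hU).comp continuous_snd))
    exact hXsnoc.comp (h1.prodMk (hf.comp (((continuous_apply 0).comp (hX.comp h1)).prodMk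
      ((continuous_apply 0).comp (hU.continuous.comp continuous_snd)))))

end Reconstruction

/-! ### Input marginals and reconstruction at the level of laws. -/

section Marginals

variable {U X : Type*} {US : Set (ℕ → U)} {XS : Set (ℕ → X)} [MeasurableSpace (Members US)]
  [MeasurableSpace (Members XS)]

theorem nonempty_of_law (μ : ProbabilityMeasure (Members XS × Members US)) :
    Nonempty (Members XS) ∧ Nonempty (Members US) := by
  obtain ⟨p⟩ := nonempty_of_isProbabilityMeasure (μ : Measure (Members XS × Members US))
  exact ⟨⟨p.1⟩, ⟨p.2⟩⟩

theorem pushforward_snd_pushforward_shift {hXS : BackwardShiftInvariant XS}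
    {hUS : BackwardShiftInvariant US} (hT : Measurable (shift hUS))
    (hS : Measurable (Prod.map (shift hXS) (shift hUS)))
    (μ : ProbabilityMeasure (Members XS × Members US)) (m : ℕ) :
    pushforward measurable_snd (pushforward (hS.iterate m) μ) =
      pushforward (hT.iterate m) (pushforward measurable_snd μ) := by
  apply Subtype.ext
  change Measure.map _ (Measure.map _ (μ : Measure (Members XS × Members US))) =
    Measure.map _ (Measure.map _ _)
  rw [Measure.map_map measurable_snd (hS.iterate m),
    Measure.map_map (hT.iterate m) measurable_snd, Prod.map_iterate]
  rfl

/-- A solution is the image, under driving the system for `m` steps, of the joint law of the states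
up to time `-m` and all inputs. -/
theorem IsStochasticSolution.map_drive {f : X × U → X} {hXS : BackwardShiftInvariant XS}
    {hUS : BackwardShiftInvariant US} {m : ℕ} (hd : Measurable (drive f hXS hUS m))
    (hXT : Measurable (shift hXS)) {μ : ProbabilityMeasure (Members XS × Members US)}
    (h : IsStochasticSolution f μ) :
    ((μ : Measure (Members XS × Members US)).map fun p => ((shift hXS)^[m] p.1, p.2)).map
      (fun p => (drive f hXS hUS m p, p.2)) = μ := by
  have hpair : Measurable fun p : Members XS × Members US => ((shift hXS)^[m] p.1, p.2) :=
    ((hXT.iterate m).comp measurable_fst).prodMk measurable_snd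
  rw [Measure.map_map (hd.prodMk measurable_snd) hpair]
  conv_rhs => rw [← Measure.map_id (μ := (μ : Measure (Members XS × Members US)))]
  refine Measure.map_congr ?_
  -- Countably many almost sure equations hold simultaneously.
  filter_upwards [ae_all_iff.2 h] with p hp
  exact Prod.ext (drive_shift_iterate hXS hUS m p.1 p.2 hp) rfl

end Marginals

/-! ### Shifting causal solutions, injectively. -/

section Solutions

variable {U X : Type*} {US : Set (ℕ → U)} {XS : Set (ℕ → X)}
  [TopologicalSpace (Members US)] [MeasurableSpace (Members US)] [BorelSpace (Members US)]
  [PolishSpace (Members US)]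
  [TopologicalSpace (Members XS)] [MeasurableSpace (Members XS)] [BorelSpace (Members XS)]
  [PolishSpace (Members XS)]

theorem IsStochasticSolution.pushforward_shift [TopologicalSpace U] [TopologicalSpace X]
    [T2Space X] {f : X × U → X} (hf : Continuous f) {hXS : BackwardShiftInvariant XS}
    {hUS : BackwardShiftInvariant US} (hU : Continuous (Members.val : Members US → ℕ → U))
    (hX : Continuous (Members.val : Members XS → ℕ → X))
    (hS : Measurable (Prod.map (shift hXS) (shift hUS)))
    {μ : ProbabilityMeasure (Members XS × Members US)} (h : IsStochasticSolution f μ) (m : ℕ) :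
    IsStochasticSolution f (pushforward (hS.iterate m) μ) := by
  intro n
  have hx : ∀ k, Continuous fun p : Members XS × Members US => p.1.val k := fun k =>
    (continuous_apply k).comp (hX.comp continuous_fst)
  have hu : Continuous fun p : Members XS × Members US => p.2.val n :=
    (continuous_apply n).comp (hU.comp continuous_snd)
  -- `X` being Hausdorff makes this set closed.
  have hmeas : MeasurableSet {p : Members XS × Members US |
      p.1.val n = f (p.1.val (n + 1), p.2.val n)} :=
    (isClosed_eq (hx n) (hf.comp ((hx (n + 1)).prodMk hu))).measurableSet
  change ∀ᵐ p ∂(Measure.map _ (μ : Measure (Members XS × Members US))), _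
  rw [ae_map_iff (hS.iterate m).aemeasurable hmeas]
  filter_upwards [h (n + m)] with p hp
  rw [Prod.map_iterate]
  simp only [Prod.map_fst, Prod.map_snd, shift_iterate_val, seqShift_iterate]
  rw [hp, show n + 1 + m = n + m + 1 by omega]

/-- Holds definitionally, as the zeroth iterate of the shift is the identity; it opens causality to
the criteria for random variables. -/
theorem isCausal_iff (hXS : BackwardShiftInvariant XS) (hUS : BackwardShiftInvariant US)
    (hT : Measurable (shift hUS)) (μ : ProbabilityMeasure (Members XS × Members US)) :
    IsCausal hXS hUS hT μ ↔ ∀ n : ℕ, CondIndepFun (inputSigma XS hUS n)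
      (inputSigma_le XS hUS hT n) (fun p : Members XS × Members US => (shift hXS)^[n] p.1)
      (fun p => p.2) (μ : Measure (Members XS × Members US)) :=
  Iff.rfl

theorem IsCausal.pushforward_shift {hXS : BackwardShiftInvariant XS}
    {hUS : BackwardShiftInvariant US} {hT : Measurable (shift hUS)}
    (hXT : Measurable (shift hXS)) (hS : Measurable (Prod.map (shift hXS) (shift hUS)))
    {μ : ProbabilityMeasure (Members XS × Members US)} (h : IsCausal hXS hUS hT μ) (m : ℕ) :
    IsCausal hXS hUS hT (pushforward (hS.iterate m) μ) := by
  obtain ⟨_, _⟩ := nonempty_of_law μ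
  rw [isCausal_iff] at h ⊢
  intro n
  have hS' : IsProbabilityMeasure (Measure.map (Prod.map (shift hXS) (shift hUS))^[m]
      (μ : Measure (Members XS × Members US))) :=
    Measure.isProbabilityMeasure_map (hS.iterate m).aemeasurable
  refine (condIndepFun_map_iff (hS.iterate m) ((hXT.iterate n).comp measurable_fst)
    measurable_snd ((hT.iterate n).comp measurable_snd)).2 ?_
  -- Causality of `μ` at time `-(n + m)` suffices: the inputs seen after the shift are a function
  -- `Tᵐ u` of all inputs `u`.
  have h1 := (h (n + m)).comp measurable_id (hT.iterate m)
  have e1 : (fun p : Members XS × Members US => (shift hXS)^[n] p.1) ∘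
      (Prod.map (shift hXS) (shift hUS))^[m] = fun p => (shift hXS)^[n + m] p.1 := by
    funext p
    simp [Prod.map_iterate, Function.iterate_add_apply]
  have e2 : (fun p : Members XS × Members US => (shift hUS)^[n] p.2) ∘
      (Prod.map (shift hXS) (shift hUS))^[m] = fun p => (shift hUS)^[n + m] p.2 := by
    funext p
    simp [Prod.map_iterate, Function.iterate_add_apply]
  have e3 : (fun p : Members XS × Members US => p.2) ∘
      (Prod.map (shift hXS) (shift hUS))^[m] = fun p => (shift hUS)^[m] p.2 := by
    funext p
    simp [Prod.map_iterate]
  change CondIndepFun (MeasurableSpace.comap ((fun p : Members XS × Members US =>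
    (shift hUS)^[n] p.2) ∘ (Prod.map (shift hXS) (shift hUS))^[m]) inferInstance) _
    ((fun p : Members XS × Members US => (shift hXS)^[n] p.1) ∘
      (Prod.map (shift hXS) (shift hUS))^[m])
    ((fun p : Members XS × Members US => p.2) ∘ (Prod.map (shift hXS) (shift hUS))^[m]) _
  simp only [e1, e2, e3]
  exact h1

/-- A causal solution is determined by its input law and its shift by `m` steps. -/
theorem IsStochasticSolution.eq_of_pushforward_shift_eq {f : X × U → X}
    {hXS : BackwardShiftInvariant XS} {hUS : BackwardShiftInvariant US}
    {hT : Measurable (shift hUS)} {m : ℕ} (hd : Measurable (drive f hXS hUS m))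
    (hXT : Measurable (shift hXS)) (hS : Measurable (Prod.map (shift hXS) (shift hUS)))
    {μ ν : ProbabilityMeasure (Members XS × Members US)}
    (hμ : IsStochasticSolution f μ) (hν : IsStochasticSolution f ν)
    (hμc : IsCausal hXS hUS hT μ) (hνc : IsCausal hXS hUS hT ν)
    (hlaw : pushforward measurable_snd μ = pushforward measurable_snd ν)
    (hpast : pushforward (hS.iterate m) μ = pushforward (hS.iterate m) ν) : μ = ν := by
  obtain ⟨_, _⟩ := nonempty_of_law μ
  have hpast' : (μ : Measure (Members XS × Members US)).map
        (fun p => ((shift hUS)^[m] p.2, (shift hXS)^[m] p.1)) =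
      (ν : Measure (Members XS × Members US)).map
        (fun p => ((shift hUS)^[m] p.2, (shift hXS)^[m] p.1)) := by
    -- The swap puts the conditioning variable, the past input, first.
    have h := congrArg (Measure.map Prod.swap) (congrArg Subtype.val hpast)
    change Measure.map _ (Measure.map _ (μ : Measure (Members XS × Members US))) =
      Measure.map _ (Measure.map _ (ν : Measure (Members XS × Members US))) at h
    rw [Measure.map_map measurable_swap (hS.iterate m),
      Measure.map_map measurable_swap (hS.iterate m), Prod.map_iterate] at h
    exact h
  have hjoint := map_prodMk_eq_of_condIndepFun ((hXT.iterate m).comp measurable_fst)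
    measurable_snd (hT.iterate m) ((isCausal_iff hXS hUS hT μ).1 hμc m)
    ((isCausal_iff hXS hUS hT ν).1 hνc m) hpast' (congrArg Subtype.val hlaw)
  apply Subtype.ext
  have h := congrArg (Measure.map fun p => (drive f hXS hUS m p, p.2)) hjoint
  exact ((hμ.map_drive hd hXT).symm.trans h).trans (hν.map_drive hd hXT)

/-- `γⁿ` appends the `n + 1` entries `u₋ₙ, …, u₀`; removing them leaves the first factor of the
product law. -/
theorem pushforward_shift_spliceLaw [TopologicalSpace U] (hUS : BackwardShiftInvariant US)
    (hU : IsInducing (Members.val : Members US → ℕ → U))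
    {Pin : Set (ProbabilityMeasure (Members US))}
    (hPin : pushforward (continuous_shift hUS hU).measurable ⁻¹' Pin = Pin)
    (Ξ' Ξ : Members Pin) (n : ℕ) :
    pushforward ((continuous_shift hUS hU).measurable.iterate (n + 1))
      (spliceLaw hUS hU hPin Ξ' Ξ n).val = Ξ'.val := by
  apply Subtype.ext
  change Measure.map _ (Measure.map _
    ((Ξ'.val : Measure (Members US)).prod (Ξ.val : Measure (Members US)))) = _
  rw [Measure.map_map ((continuous_shift hUS hU).measurable.iterate (n + 1))
    (continuous_splice hUS hU n).measurable,
    show (shift hUS)^[n + 1] ∘ splice hUS n = Prod.fst from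
      funext (shift_iterate_splice hUS n)]
  simp

/-- Concatenating an input law `Ξ'` with another one does not increase the number of causal
stochastic solutions. -/
theorem encard_causalSolutions_spliceLaw_le [TopologicalSpace U] [TopologicalSpace X] [T2Space X]
    {f : X × U → X} (hf : Continuous f) (hUS : BackwardShiftInvariant US)
    (hXS : BackwardShiftInvariant XS)
    (hU : IsInducing (Members.val : Members US → ℕ → U))
    (hX : Continuous (Members.val : Members XS → ℕ → X))
    (hXshift : Continuous (shift hXS))
    (hXsnoc : Continuous fun p : Members XS × X => snoc hXS p.1 p.2)
    {Pin : Set (ProbabilityMeasure (Members US))}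
    {Pstate : Set (ProbabilityMeasure (Members XS × Members US))}
    (hPin : pushforward (continuous_shift hUS hU).measurable ⁻¹' Pin = Pin)
    (hPstate : pushforward
      (hXshift.measurable.prodMap (continuous_shift hUS hU).measurable) ⁻¹' Pstate = Pstate)
    (Ξ' Ξ : Members Pin) (n : ℕ) :
    (causalSolutions f hXS hUS (continuous_shift hUS hU).measurable Pstate
        (spliceLaw hUS hU hPin Ξ' Ξ n).val).encard ≤
      (causalSolutions f hXS hUS (continuous_shift hUS hU).measurable Pstate Ξ'.val).encard := by
  have hT := (continuous_shift hUS hU).measurable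
  have hS := hXshift.measurable.prodMap hT
  refine Set.encard_le_encard_of_injOn
    (f := fun μ : Members Pstate => (⟨pushforward (hS.iterate (n + 1)) μ.val,
      (pushforward_iterate_mem hS hPstate (n + 1) μ.val).2 μ.property⟩ : Members Pstate)) ?_ ?_
  · rintro μ ⟨hsol, hcausal, hlaw⟩
    refine ⟨hsol.pushforward_shift hf hU.continuous hX hS (n + 1),
      hcausal.pushforward_shift hXshift.measurable hS (n + 1), ?_⟩
    rw [pushforward_snd_pushforward_shift hT hS, hlaw]
    exact pushforward_shift_spliceLaw hUS hU hPin Ξ' Ξ n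
  -- Both solutions have the same spliced input law, so equality of their shifts forces equality.
  · rintro μ ⟨hsol, hcausal, hlaw⟩ ν ⟨hsol', hcausal', hlaw'⟩ h
    exact Members.ext (hsol.eq_of_pushforward_shift_eq
      (continuous_drive hf hXS hUS hU hX hXsnoc (n + 1)).measurable hXshift.measurable hS hsol'
      hcausal hcausal' (hlaw.trans hlaw'.symm) (congrArg Members.val h))

end Solutions

end SSS

/-! ### The proposition. -/

theorem mainTheorem5 {U X : Type*} [TopologicalSpace U] [T2Space U]
    [TopologicalSpace X] [T2Space X]
    (f : X × U → X) (hf : Continuous f)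
    -- the sets of input sequences and of state sequences
    (US : Set (ℕ → U)) (hUS : SSS.BackwardShiftInvariant US)
    (XS : Set (ℕ → X)) (hXS : SSS.BackwardShiftInvariant XS)
    [TopologicalSpace (SSS.Members US)] [MeasurableSpace (SSS.Members US)]
    [BorelSpace (SSS.Members US)] [PolishSpace (SSS.Members US)]
    [TopologicalSpace (SSS.Members XS)] [MeasurableSpace (SSS.Members XS)]
    [BorelSpace (SSS.Members XS)] [PolishSpace (SSS.Members XS)]
    -- input sequences carry the product topology
    (hU : IsInducing (SSS.Members.val : SSS.Members US → ℕ → U))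
    -- state sequences carry a topology at least as fine as the product topology, for which the
    -- right shift and the concatenation are continuous
    (hX : Continuous (SSS.Members.val : SSS.Members XS → ℕ → X))
    (hXshift : Continuous (SSS.shift hXS))
    (hXsnoc : Continuous fun p : SSS.Members XS × X => SSS.snoc hXS p.1 p.2)
    -- the sets of input laws and of state-input laws
    (Pin : Set (ProbabilityMeasure (SSS.Members US)))
    (Pstate : Set (ProbabilityMeasure (SSS.Members XS × SSS.Members US)))
    (hPin : SSS.pushforward (SSS.continuous_shift hUS hU).measurable ⁻¹' Pin = Pin)
    (hPstate : SSS.pushforward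
      (hXshift.measurable.prodMap (SSS.continuous_shift hUS hU).measurable) ⁻¹' Pstate = Pstate)
    (hmarg : SSS.pushforward measurable_snd '' Pstate = Pin)
    -- topologies at least as fine as the weak topologies
    [TopologicalSpace (SSS.Members Pin)] [TopologicalSpace (SSS.Members Pstate)]
    (hPinTop : Continuous
      (SSS.Members.val : SSS.Members Pin → ProbabilityMeasure (SSS.Members US)))
    (hPstateTop : Continuous (SSS.Members.val :
      SSS.Members Pstate → ProbabilityMeasure (SSS.Members XS × SSS.Members US)))
    -- convergence of concatenated input laws
    (hconcat : ∀ Ξ Ξ' : SSS.Members Pin,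
      Tendsto (fun n : ℕ => SSS.spliceLaw hUS hU hPin Ξ' Ξ n) atTop (𝓝 Ξ)) :
    -- the number of causal stochastic solutions is a constant `M` on the set of input laws with
    -- the causal stochastic FMP, and is at least `M` everywhere
    (∃ M : ℕ∞,
      (∀ Ξ ∈ SSS.causalFMPSet f hXS hUS (SSS.continuous_shift hUS hU).measurable Pin Pstate,
        (SSS.causalSolutions f hXS hUS (SSS.continuous_shift hUS hU).measurable
          Pstate Ξ.val).encard = M) ∧
      (∀ Ξ : SSS.Members Pin,
        M ≤ (SSS.causalSolutions f hXS hUS (SSS.continuous_shift hUS hU).measurable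
          Pstate Ξ.val).encard)) ∧
    (SSS.HasCausalStochasticFMP f hXS hUS (SSS.continuous_shift hUS hU).measurable Pin Pstate →
      ∃ M : ℕ∞, ∀ Ξ : SSS.Members Pin,
        (SSS.causalSolutions f hXS hUS (SSS.continuous_shift hUS hU).measurable
          Pstate Ξ.val).encard = M) ∧
    (SSS.HasCausalStochasticFMP f hXS hUS (SSS.continuous_shift hUS hU).measurable Pin Pstate →
      (∃ Ξ : SSS.Members Pin,
        (SSS.causalSolutions f hXS hUS (SSS.continuous_shift hUS hU).measurable
          Pstate Ξ.val).encard = 1) →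
      SSS.HasCausalStochasticESP f hXS hUS (SSS.continuous_shift hUS hU).measurable
        Pin Pstate) := by
  -- The weak topology is Hausdorff, and a finer topology inherits this.
  have : T2Space (SSS.Members Pstate) :=
    T2Space.of_injective_continuous (fun _ _ h => SSS.Members.ext h) hPstateTop
  have hle : ∀ Ξ ∈ SSS.causalFMPSet f hXS hUS (SSS.continuous_shift hUS hU).measurable Pin Pstate,
      ∀ Ξ' : SSS.Members Pin,
        (SSS.causalSolutions f hXS hUS (SSS.continuous_shift hUS hU).measurable
          Pstate Ξ.val).encard ≤
        (SSS.causalSolutions f hXS hUS (SSS.continuous_shift hUS hU).measurable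
          Pstate Ξ'.val).encard := fun Ξ hΞ Ξ' =>
    SSS.HemicontinuousAt.encard_le_of_tendsto
      (F := fun Ξ : SSS.Members Pin => SSS.causalSolutions f hXS hUS
        (SSS.continuous_shift hUS hU).measurable Pstate Ξ.val) hΞ (hconcat Ξ Ξ') fun n =>
      SSS.encard_causalSolutions_spliceLaw_le hf hUS hXS hU hX hXshift hXsnoc hPin hPstate Ξ' Ξ n
  refine ⟨?_, fun h => ?_, fun h => ?_⟩
  · rcases Set.eq_empty_or_nonempty
      (SSS.causalFMPSet f hXS hUS (SSS.continuous_shift hUS hU).measurable Pin Pstate)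
      with hD | ⟨Ξ₀, hΞ₀⟩
    -- With `D` empty the equality is vacuous, and `0` is a lower bound.
    · exact ⟨0, by simp [hD], fun _ => zero_le⟩
    · exact ⟨_, fun Ξ hΞ => le_antisymm (hle Ξ hΞ Ξ₀) (hle Ξ₀ hΞ₀ Ξ), hle Ξ₀ hΞ₀⟩
  · have hD : ∀ Ξ, Ξ ∈ SSS.causalFMPSet f hXS hUS (SSS.continuous_shift hUS hU).measurable Pin
        Pstate := fun Ξ => h.symm ▸ Set.mem_univ Ξ
    rcases isEmpty_or_nonempty (SSS.Members Pin) with _ | ⟨⟨Ξ₀⟩⟩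
    · exact ⟨0, fun Ξ => isEmptyElim Ξ⟩
    · exact ⟨_, fun Ξ => le_antisymm (hle Ξ (hD Ξ) Ξ₀) (hle Ξ₀ (hD Ξ₀) Ξ)⟩
  · have hD : ∀ Ξ, Ξ ∈ SSS.causalFMPSet f hXS hUS (SSS.continuous_shift hUS hU).measurable Pin
        Pstate := fun Ξ => h.symm ▸ Set.mem_univ Ξ
    rintro ⟨Ξ₀, hΞ₀⟩ Ξ
    have h1 := (le_antisymm (hle Ξ (hD Ξ) Ξ₀) (hle Ξ₀ (hD Ξ₀) Ξ)).trans hΞ₀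
    obtain ⟨μ, hμ⟩ := Set.encard_eq_one.1 h1
    exact ⟨μ, hμ.ge rfl, fun ν hν => hμ.le hν⟩
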